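/- Let $\mathbb T^2=\mathbb R^2/\mathbb Z^2$ carry Lebesgue (Haar) probability measure $\mu$. Let $v:\mathbb T^2\to\mathbb R$ be bounded and measurable, and of class $C^1$ when regarded as a function on the half-open square $[0,1)^2$; let $c>0$. Then there is a constant $C_0>0$, depending only on $v$ and $c$, with the following property. Let $A\in \mathrm{SL}(2,\mathbb Z)$ be any hyperbolic matrix with eigenvalues $\beta,\beta^{-1}$, where $\beta>1$, let $T\omega=A\omega \bmod \mathbb Z^2$ be the induced automorphism of $\mathbb T^2$, and let $u\in\mathbb R^2$ be a unit vector with $Au=\beta u$. Suppose that $D_u v(\omega)>c$ for all $\omega\in[0,1)^2$ (with one-sided derivatives on the edges belonging to the square). For $E\in\mathbb R$ and $\lambda>0$ put $$A^{(E-\lambda v)}(\omega)=\begin{pmatrix}E-\lambda v(\omega)&-1\\1&0\end{pmatrix},\qquad A^{(E-\lambda v)}_n(\omega)=A^{(E-\lambda v)}(T^{n-1}\omega)\cdots A^{(E-\lambda v)}(\omega).$$ Then for all $\lambda>0$ and all $E\in\mathbb R$, the functions $\log\|A^{(E-\lambda v)}_n\|$ ($n\ge 0$) are $\mu$-integrable,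 the limit $$L(E;\lambda)=\lim_{n\to\infty}\frac1n\int_{\mathbb T^2}\log\|A^{(E-\lambda v)}_n(\omega)\|\,d\mu(\omega)$$ exists, and $$L(E;\lambda)>\log\lambda-C_0 .$$ -/

import Mathlib

open MeasureTheory Filter Topology

open scoped Matrix.Norms.L2Operator

noncomputable section

/-- The real matrix with the entries of an integer matrix of determinant one. -/
def realMatrix (A : Matrix.SpecialLinearGroup (Fin 2) ℤ) : Matrix (Fin 2) (Fin 2) ℝ :=
  (A : Matrix (Fin 2) (Fin 2) ℤ).map (fun k : ℤ => (k : ℝ))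

/-- The automorphism `ω ↦ A ω mod ℤ²` of the torus `𝕋² = (ℝ/ℤ)²` induced by `A ∈ SL(2,ℤ)`. -/
def toralMap (A : Matrix.SpecialLinearGroup (Fin 2) ℤ) (ω : UnitAddTorus (Fin 2)) :
    UnitAddTorus (Fin 2) :=
  fun i => ∑ j, A i j • ω j

/-- The half-open fundamental domain `[0,1)²` of the torus, inside the Euclidean plane. -/
def fundamentalSquare : Set (EuclideanSpace ℝ (Fin 2)) :=
  {x | ∀ i, x i ∈ Set.Ico (0 : ℝ) 1}

/-- The `ℤ²`-periodic function on the plane given by a function on the torus. -/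
def periodicLift (v : UnitAddTorus (Fin 2) → ℝ) (x : EuclideanSpace ℝ (Fin 2)) : ℝ :=
  v (fun i => ((x i : ℝ) : UnitAddCircle))

/-- The derivative at `x ∈ [0,1)²`, in the direction `u`, of `v` as a function on `[0,1)²`
(one-sided on the edges that belong to the square). -/
def squareDirDeriv (v : UnitAddTorus (Fin 2) → ℝ) (u x : EuclideanSpace ℝ (Fin 2)) : ℝ :=
  fderivWithin ℝ (periodicLift v) fundamentalSquare x u

/-- The Schrödinger cocycle map of energy `E`, coupling constant `lam` and potential `v`. -/
def schrodingerMatrix (v : UnitAddTorus (Fin 2) → ℝ) (E lam : ℝ) (ω : UnitAddTorus (Fin 2)) :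
    Matrix (Fin 2) (Fin 2) ℝ :=
  !![E - lam * v ω, -1; 1, 0]

/-- The `n`-step transfer matrix `M(Tⁿ⁻¹ ω) ⋯ M(T ω) M(ω)`, where `M` is the Schrödinger cocycle
map and `T` is the toral automorphism given by `A`. -/
def transferMatrix (A : Matrix.SpecialLinearGroup (Fin 2) ℤ) (v : UnitAddTorus (Fin 2) → ℝ)
    (E lam : ℝ) : ℕ → UnitAddTorus (Fin 2) → Matrix (Fin 2) (Fin 2) ℝ
  | 0, _ => 1
  | n + 1, ω => schrodingerMatrix v E lam ((toralMap A)^[n] ω) * transferMatrix A v E lam n ω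

/-- The averages `(1/n) ∫ log ‖Aₙ(ω)‖ dμ(ω)`, with the Euclidean operator norm of matrices and
the Lebesgue (Haar) probability measure of the torus. -/
def averagedLogNorm (A : Matrix.SpecialLinearGroup (Fin 2) ℤ) (v : UnitAddTorus (Fin 2) → ℝ)
    (E lam : ℝ) (n : ℕ) : ℝ :=
  (1 / (n : ℝ)) * ∫ ω, Real.log ‖transferMatrix A v E lam n ω‖

/-- The Lyapunov exponent `L(E; lam)`, the limit of the averages above. -/
def lyapunovExponent (A : Matrix.SpecialLinearGroup (Fin 2) ℤ) (v : UnitAddTorus (Fin 2) → ℝ)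
    (E lam : ℝ) : ℝ :=
  limUnder atTop (averagedLogNorm A v E lam)

end

/-! The first column of the transfer matrix consists of continuants `D`, and the ratios `D (n + 1) /
D n` follow the projective maps `m ↦ a k - 1 / m` with `a k = E - lam * v (T^k ω)`. Since
`‖transferMatrix n‖ ≥ |D (n + 1)|`, and `|D (n + 1)|` is the product of the ratios up to time `n`,
it is enough that no ratio is often much smaller than `lam`.

The key estimate is that the ratio lies within `lam * ε` of zero with probability at most `(16 / c)
* ε`. Projective maps lift to monotone maps of the universal cover, monotone also in `a`.
Translating `ω` by `(h / β^n) • u` moves `T^k ω` by `h * β^(k - n)` along `u`. This raises `v`,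
hence lowers `a k`, unless the segment leaves the square, which has probability at most `2 * h *
β^(k - n)`. Each such exit costs a bounded number of turns (`coverOrbit_le`). When all steps are
good, the last parameter drops by at least `δ = lam * c * h`, so an orbit whose ratio is near zero
loses a full turn (`turnCount_add_le`). The turn count is bounded and the translation preserves Haar
measure, so integration cancels the two turn counts and bounds the probability of a small ratio by
the total exit probability (`measureReal_abs_continuant_div_lt_le`). The exit probabilities form a
geometric series, and `β ≥ 2` makes its bound uniform in `A` and `n`.

Integrating this tail bound, each step loses at most `16 / c` from `log lam` on average
(`integrable_posPart_log_sub`), and telescoping finishes. The limit exists by subadditivity. -/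

/-! ### Projective dynamics on the universal cover -/

/-- The action of `m ↦ a - 1 / m` on the projective line `ℝ ∪ {∞}`, with `∞` written as `⊤`. -/
noncomputable def projStep (a : ℝ) : WithTop ℝ → WithTop ℝ
  | ⊤ => (a : WithTop ℝ)
  | (m : ℝ) => if m = 0 then ⊤ else ((a - 1 / m : ℝ) : WithTop ℝ)

open Classical in
/-- The lift of `projStep a` to the universal cover `ℤ × (ℝ ∪ {∞})` of the projective line. -/
noncomputable def coverStep (a : ℝ) (X : ℤ × WithTop ℝ) : ℤ × WithTop ℝ :=
  (X.1 - (if X.2 ≤ 0 then 1 else 0), projStep a X.2)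

/-- The lexicographic order of the universal cover, up to `r` turns. -/
def CoverLE (r : ℤ) (X Y : ℤ × WithTop ℝ) : Prop :=
  X.1 < Y.1 + r ∨ X.1 = Y.1 + r ∧ X.2 ≤ Y.2

lemma projStep_top (a : ℝ) : projStep a ⊤ = (a : WithTop ℝ) := rfl

lemma projStep_coe (a m : ℝ) :
    projStep a (m : WithTop ℝ) = if m = 0 then ⊤ else ((a - 1 / m : ℝ) : WithTop ℝ) := rfl

lemma projStep_add (a s : ℝ) (x : WithTop ℝ) :
    projStep (a + s) x = projStep a x + (s : WithTop ℝ) := by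
  cases x with
  | top => rw [projStep_top, projStep_top]; norm_cast
  | coe m =>
    rw [projStep_coe, projStep_coe]
    split_ifs
    · simp
    · norm_cast; ring

/-- The map is increasing on each of the branches `(0, ∞]` and `(-∞, 0]`, whose images lie on either
side of `a`. Lowering the sheet of the second branch by one therefore makes the lift increasing. -/
lemma projStep_le_of_pos {a : ℝ} {x : WithTop ℝ} (hx : 0 < x) :
    projStep a x ≤ (a : WithTop ℝ) := by
  cases x with
  | top => exact le_rfl
  | coe m =>
    have hm : 0 < m := by exact_mod_cast hx
    rw [projStep_coe, if_neg hm.ne']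
    have : 0 < 1 / m := by positivity
    exact_mod_cast (by linarith : a - 1 / m ≤ a)

lemma le_projStep_of_nonpos {a : ℝ} {x : WithTop ℝ} (hx : x ≤ 0) :
    (a : WithTop ℝ) ≤ projStep a x := by
  cases x with
  | top => simp at hx
  | coe m =>
    have hm : m ≤ 0 := by exact_mod_cast hx
    rw [projStep_coe]
    split_ifs with h
    · exact le_top
    · have : 1 / m ≤ 0 := one_div_nonpos.2 hm
      exact_mod_cast (by linarith : a ≤ a - 1 / m)

lemma projStep_mono_of_pos {a b : ℝ} (hab : a ≤ b) {x y : WithTop ℝ} (hx : 0 < x)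
    (hxy : x ≤ y) : projStep a x ≤ projStep b y := by
  cases y with
  | top => exact (projStep_le_of_pos hx).trans (by rw [projStep_top]; exact_mod_cast hab)
  | coe n =>
    cases x with
    | top => simp at hxy
    | coe m =>
      have hm : 0 < m := by exact_mod_cast hx
      have hmn : m ≤ n := by exact_mod_cast hxy
      rw [projStep_coe, projStep_coe, if_neg hm.ne', if_neg (hm.trans_le hmn).ne']
      have := one_div_le_one_div_of_le hm hmn
      exact_mod_cast (by linarith : a - 1 / m ≤ b - 1 / n)

lemma projStep_mono_of_nonpos {a b : ℝ} (hab : a ≤ b) {x y : WithTop ℝ} (hy : y ≤ 0)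
    (hxy : x ≤ y) : projStep a x ≤ projStep b y := by
  cases y with
  | top => simp at hy
  | coe n =>
    cases x with
    | top => simp at hxy
    | coe m =>
      have hn : n ≤ 0 := by exact_mod_cast hy
      have hmn : m ≤ n := by exact_mod_cast hxy
      rw [projStep_coe, projStep_coe]
      rcases hn.eq_or_lt with rfl | hn
      · simp
      · rw [if_neg (hmn.trans_lt hn).ne, if_neg hn.ne]
        have := one_div_le_one_div_of_neg_of_le hn hmn
        exact_mod_cast (by linarith : a - 1 / m ≤ b - 1 / n)

lemma CoverLE.coverStep {r : ℤ} {X Y : ℤ × WithTop ℝ} (h : CoverLE r X Y) {a b : ℝ}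
    (hab : a ≤ b) : CoverLE r (coverStep a X) (coverStep b Y) := by
  unfold CoverLE _root_.coverStep at *
  dsimp only
  rcases h with h | ⟨h, hle⟩
  · by_cases hx : X.2 ≤ 0 <;> by_cases hy : Y.2 ≤ 0
    · left; simp only [hx, hy, if_true]; omega
    · left; simp only [hx, hy, if_true, if_false]; omega
    · simp only [hx, hy, if_true, if_false]
      -- The only case where the strict inequality between sheets can be lost: `Y` drops a sheet and
      -- `X` does not. The images are then separated by the values `a ≤ b`.
      by_cases h' : X.1 - 0 < Y.1 - 1 + r
      · exact Or.inl h'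
      · refine Or.inr ⟨by omega, ?_⟩
        exact (projStep_le_of_pos (not_le.1 hx)).trans
          (le_trans (by exact_mod_cast hab) (le_projStep_of_nonpos hy))
    · left; simp only [hx, hy, if_false]; omega
  · by_cases hx : X.2 ≤ 0 <;> by_cases hy : Y.2 ≤ 0
    · right; simp only [hx, hy, if_true]
      exact ⟨by omega, projStep_mono_of_nonpos hab hy hle⟩
    · left; simp only [hx, hy, if_true, if_false]; omega
    · exact absurd (hle.trans hy) hx
    · right; simp only [hx, hy, if_false]
      exact ⟨by omega, projStep_mono_of_pos hab (not_le.1 hx) hle⟩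

/-- The new sheet does not depend on the parameter, so both steps may be taken with the same one. -/
lemma CoverLE.fst_coverStep_le {r : ℤ} {X Y : ℤ × WithTop ℝ} (h : CoverLE r X Y) (a b : ℝ) :
    (_root_.coverStep a X).1 ≤ (_root_.coverStep b Y).1 + r := by
  have := h.coverStep (le_refl a)
  rcases this with h | h
  · exact h.le
  · exact h.1.le

/-- A step with uncontrolled parameters costs at most one turn. -/
lemma CoverLE.coverStep_succ {r : ℤ} {X Y : ℤ × WithTop ℝ} (h : CoverLE r X Y) (a b : ℝ) :
    CoverLE (r + 1) (_root_.coverStep a X) (_root_.coverStep b Y) := by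
  have := h.fst_coverStep_le a b
  left; omega

/-- The lifted orbit of `∞` under the projective maps with parameters `a 0, a 1, …`. -/
noncomputable def coverOrbit (a : ℕ → ℝ) : ℕ → ℤ × WithTop ℝ
  | 0 => (0, ⊤)
  | n + 1 => coverStep (a n) (coverOrbit a n)

open Classical in
/-- The number of turns of the lifted orbit, counted with respect to the point `-s`. -/
noncomputable def turnCount (a : ℕ → ℝ) (s : ℝ) (n : ℕ) : ℤ :=
  (coverOrbit a n).1 - (if (coverOrbit a n).2 + (s : WithTop ℝ) ≤ 0 then 1 else 0)

lemma coverOrbit_le {a a' : ℕ → ℝ} {bad : ℕ → Prop} [DecidablePred bad] {n : ℕ}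
    (h : ∀ k < n, ¬ bad k → a' k ≤ a k) :
    CoverLE (∑ k ∈ Finset.range n, if bad k then 1 else 0) (coverOrbit a' n)
      (coverOrbit a n) := by
  induction n with
  | zero => right; simp [coverOrbit]
  | succ n ih =>
    have ih := ih fun k hk => h k (hk.trans n.lt_succ_self)
    rw [Finset.sum_range_succ]
    by_cases hb : bad n
    · rw [if_pos hb]; exact ih.coverStep_succ _ _
    · rw [if_neg hb, add_zero]; exact ih.coverStep (h n n.lt_succ_self hb)

/-- Adding `s` to the last parameter translates the ratio by `s`, so counting turns at `-s` is
reading off the sheet after one more step. The parameter `b` of that step is irrelevant. -/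
lemma turnCount_succ_eq (a : ℕ → ℝ) (s : ℝ) (n : ℕ) (b : ℝ) :
    turnCount a s (n + 1) = (coverStep b (coverStep (a n + s) (coverOrbit a n))).1 := by
  simp only [turnCount, coverOrbit, coverStep, projStep_add]
  congr

open Classical in
lemma turnCount_add_le {a a' : ℕ → ℝ} {bad : ℕ → Prop} {n : ℕ} {δ : ℝ} (s : ℝ) (hδ : 0 ≤ δ)
    (h : ∀ k < n, ¬ bad k → a' k ≤ a k) (hn : ¬ bad n → a' n ≤ a n - δ) :
    turnCount a' s (n + 1) + (if 0 < (coverOrbit a (n + 1)).2 + (s : WithTop ℝ) ∧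
        (coverOrbit a (n + 1)).2 + (s : WithTop ℝ) ≤ (δ : WithTop ℝ) then 1 else 0) ≤
      turnCount a s (n + 1) + 2 * ∑ k ∈ Finset.range (n + 1), if bad k then 1 else 0 := by
  have h1 := coverOrbit_le h
  rw [turnCount_succ_eq a s n 0, turnCount_succ_eq a' s n 0, Finset.sum_range_succ]
  have hr : 0 ≤ ∑ k ∈ Finset.range n, (if bad k then 1 else 0 : ℤ) :=
    Finset.sum_nonneg fun k _ => by split_ifs <;> simp
  set r := ∑ k ∈ Finset.range n, (if bad k then 1 else 0 : ℤ)
  have hY : (coverOrbit a (n + 1)).2 + (s : WithTop ℝ) =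
      (coverStep (a n + s) (coverOrbit a n)).2 := by
    simp [coverOrbit, coverStep, projStep_add]
  rw [hY]
  -- A bad last step costs one turn for the step and one for the indicator on the left; hence the
  -- factor 2.
  by_cases hb : bad n
  · have := (h1.coverStep_succ (a' n + s) (a n + s)).fst_coverStep_le 0 0
    rw [if_pos hb]
    split_ifs <;> omega
  · rw [if_neg hb]
    have h2 := h1.coverStep (a := a' n + s) (b := a n + s + -δ) (by linarith [hn hb])
    have h3 := h1.coverStep (a := a' n + s) (b := a n + s) (by linarith [hn hb])
    have h4 := h3.fst_coverStep_le 0 0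
    split_ifs with hs
    · have h5 := h2.fst_coverStep_le 0 0
      -- Lowering the last parameter by `δ` carries a point of `(0, δ]` to `(-∞, 0]`, so the next
      -- step drops a sheet that it would otherwise keep.
      have h6 : (coverStep (a n + s + -δ) (coverOrbit a n)).2 ≤ 0 := by
        simp only [coverStep] at hs ⊢
        rw [projStep_add]
        cases hx : projStep (a n + s) (coverOrbit a n).2 with
        | top => rw [hx] at hs; simp at hs
        | coe m =>
          rw [hx] at hs
          have : m ≤ δ := by exact_mod_cast hs.2
          exact_mod_cast (by linarith : m + -δ ≤ 0)
      have h7 : (coverStep 0 (coverStep (a n + s + -δ) (coverOrbit a n))).1 =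
          (coverOrbit a (n + 1)).1 - 1 := by
        rw [coverStep, if_pos h6]; rfl
      have h8 : (coverStep 0 (coverStep (a n + s) (coverOrbit a n))).1 =
          (coverOrbit a (n + 1)).1 := by
        rw [coverStep, if_neg (not_le.2 hs.1), sub_zero]; rfl
      omega
    · omega

/-! ### Continuants as homogeneous coordinates of the orbit -/

/-- The solution of `D (n + 2) = a n * D (n + 1) - D n` with `D 0 = 0` and `D 1 = 1`. -/
def continuant (a : ℕ → ℝ) : ℕ → ℝ
  | 0 => 0
  | 1 => 1
  | n + 2 => a n * continuant a (n + 1) - continuant a n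

lemma continuant_ne_zero_or (a : ℕ → ℝ) (n : ℕ) :
    continuant a n ≠ 0 ∨ continuant a (n + 1) ≠ 0 := by
  induction n with
  | zero => simp [continuant]
  | succ n ih =>
    by_contra! h
    obtain ⟨h1, h2⟩ := h
    rw [continuant, h1, mul_zero, zero_sub, neg_eq_zero] at h2
    exact ih.elim (fun h => h h2) fun h => h h1

lemma snd_coverOrbit (a : ℕ → ℝ) (n : ℕ) :
    (coverOrbit a n).2 = if continuant a n = 0 then ⊤ else
      ((continuant a (n + 1) / continuant a n : ℝ) : WithTop ℝ) := by
  induction n with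
  | zero => simp [coverOrbit, continuant]
  | succ n ih =>
    rw [coverOrbit, coverStep, ih]
    dsimp only
    have hor := continuant_ne_zero_or a n
    by_cases h0 : continuant a n = 0
    · have h1 : continuant a (n + 1) ≠ 0 := by simpa [h0] using hor
      rw [if_pos h0, if_neg h1, projStep_top, continuant, h0]
      congr 1; field_simp; ring
    · by_cases h1 : continuant a (n + 1) = 0
      · rw [if_neg h0, if_pos h1, projStep_coe, if_pos (by simp [h1])]
      · rw [if_neg h0, if_neg h1, projStep_coe, if_neg (div_ne_zero h1 h0), continuant]
        congr 1; field_simp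

open Classical in
lemma turnCount_eq (a : ℕ → ℝ) (s : ℝ) (n : ℕ) :
    turnCount a s n = (coverOrbit a n).1 - (if continuant a n ≠ 0 ∧
      continuant a (n + 1) / continuant a n + s ≤ 0 then 1 else 0) := by
  rw [turnCount, snd_coverOrbit]
  by_cases h : continuant a n = 0
  · simp [h]
  · simp only [h, if_false, ne_eq, not_false_eq_true, true_and]
    norm_cast

/-- This drives the induction for measurability of the sheet number. -/
lemma fst_coverOrbit_succ (a : ℕ → ℝ) (n : ℕ) :
    (coverOrbit a (n + 1)).1 = turnCount a 0 n := by
  simp [turnCount, coverOrbit, coverStep]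

lemma abs_fst_coverOrbit_le (a : ℕ → ℝ) (n : ℕ) : |(coverOrbit a n).1| ≤ n := by
  induction n with
  | zero => simp [coverOrbit]
  | succ n ih =>
    rw [coverOrbit, coverStep]
    rw [abs_le] at *
    push_cast
    split_ifs <;> omega

lemma abs_turnCount_le (a : ℕ → ℝ) (s : ℝ) (n : ℕ) : |turnCount a s n| ≤ n + 1 := by
  have := abs_fst_coverOrbit_le a n
  rw [turnCount]
  rw [abs_le] at *
  split_ifs <;> omega

/-! ### Averaging the turn count over a measure preserving map -/

section Measure

variable {Ω : Type*} [MeasurableSpace Ω] {a : ℕ → Ω → ℝ}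

lemma measurable_continuant (ha : ∀ k, Measurable (a k)) (n : ℕ) :
    Measurable fun ω => continuant (fun k => a k ω) n := by
  have : (Measurable fun ω => continuant (fun k => a k ω) n) ∧
      Measurable fun ω => continuant (fun k => a k ω) (n + 1) := by
    induction n with
    | zero => simp [continuant]
    | succ n ih => exact ⟨ih.2, ((ha n).mul ih.2).sub ih.1⟩
  exact this.1

lemma measurable_turnCount_of (ha : ∀ k, Measurable (a k)) (s : ℝ) (n : ℕ)
    (h : Measurable fun ω => (coverOrbit (fun k => a k ω) n).1) :
    Measurable fun ω => turnCount (fun k => a k ω) s n := by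
  classical
  simp only [turnCount_eq]
  have h0 := measurable_continuant ha n
  have h1 := measurable_continuant ha (n + 1)
  refine h.sub (Measurable.ite ?_ measurable_const measurable_const)
  exact ((measurableSet_eq_fun h0 measurable_const).compl).inter
    (measurableSet_le ((h1.div h0).add_const s) measurable_const)

lemma measurable_fst_coverOrbit (ha : ∀ k, Measurable (a k)) (n : ℕ) :
    Measurable fun ω => (coverOrbit (fun k => a k ω) n).1 := by
  induction n with
  | zero => simp [coverOrbit]
  | succ n ih => simpa only [fst_coverOrbit_succ] using measurable_turnCount_of ha 0 n ih

lemma measurable_turnCount (ha : ∀ k, Measurable (a k)) (s : ℝ) (n : ℕ) :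
    Measurable fun ω => turnCount (fun k => a k ω) s n :=
  measurable_turnCount_of ha s n (measurable_fst_coverOrbit ha n)

/-- If a measure preserving map decreases the parameters off the sets `bad k`, and the last one
by `δ`, then the quotient of consecutive continuants is seldom within `δ / 2` of zero. -/
lemma measureReal_abs_continuant_div_lt_le {μ : Measure Ω} [IsProbabilityMeasure μ] {τ : Ω → Ω}
    (hτ : MeasurePreserving τ μ μ) (ha : ∀ k, Measurable (a k)) {bad : ℕ → Set Ω}
    (hbad : ∀ k, MeasurableSet (bad k)) {n : ℕ} {δ : ℝ} (hδ : 0 ≤ δ)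
    (h : ∀ k < n, ∀ ω ∉ bad k, a k (τ ω) ≤ a k ω)
    (hn : ∀ ω ∉ bad n, a n (τ ω) ≤ a n ω - δ) :
    μ.real {ω | continuant (fun k => a k ω) (n + 1) ≠ 0 ∧
      |continuant (fun k => a k ω) (n + 2) / continuant (fun k => a k ω) (n + 1)| < δ / 2} ≤
      2 * ∑ k ∈ Finset.range (n + 1), μ.real (bad k) := by
  classical
  set S := {ω | continuant (fun k => a k ω) (n + 1) ≠ 0 ∧
      |continuant (fun k => a k ω) (n + 2) / continuant (fun k => a k ω) (n + 1)| < δ / 2}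
  have h1 := measurable_continuant ha (n + 1)
  have h2 := measurable_continuant ha (n + 2)
  have hS : MeasurableSet S := ((measurableSet_eq_fun h1 measurable_const).compl).inter
    (measurableSet_lt (h2.div h1).norm measurable_const)
  set N : Ω → ℝ := fun ω => (turnCount (fun k => a k ω) (δ / 2) (n + 1) : ℝ)
  have hNm : Measurable N :=
    (measurable_from_top (f := fun z : ℤ => (z : ℝ))).comp
      (measurable_turnCount ha (δ / 2) (n + 1))
  have hNi : Integrable N μ := by
    refine Integrable.of_bound hNm.aestronglyMeasurable (n + 2 : ℝ) (ae_of_all _ fun ω => ?_)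
    have := abs_turnCount_le (fun k => a k ω) (δ / 2) (n + 1)
    rw [Real.norm_eq_abs]
    have h' : ((|turnCount (fun k => a k ω) (δ / 2) (n + 1)| : ℤ) : ℝ) ≤
      (((n + 1 : ℕ) : ℤ) + 1 : ℤ) := by exact_mod_cast this
    push_cast at h'
    linarith
  have hpt : ∀ ω, N (τ ω) + S.indicator 1 ω ≤
      N ω + 2 * ∑ k ∈ Finset.range (n + 1), (bad k).indicator (1 : Ω → ℝ) ω := by
    intro ω
    -- The choice `s = δ / 2` centres the window `(0, δ]` at ratio zero.
    have key := turnCount_add_le (a := fun k => a k ω) (a' := fun k => a k (τ ω))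
      (bad := fun k => ω ∈ bad k) (n := n) (δ := δ) (δ / 2) hδ (fun k hk => h k hk ω) (hn ω)
    have e1 : S.indicator (1 : Ω → ℝ) ω ≤ ((if 0 < (coverOrbit (fun k => a k ω) (n + 1)).2 +
        ((δ / 2 : ℝ) : WithTop ℝ) ∧ (coverOrbit (fun k => a k ω) (n + 1)).2 +
        ((δ / 2 : ℝ) : WithTop ℝ) ≤ (δ : WithTop ℝ) then 1 else 0 : ℤ) : ℝ) := by
      by_cases hω : ω ∈ S
      · have hω' := hω
        obtain ⟨hne, hlt⟩ := hω
        rw [abs_lt] at hlt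
        rw [Set.indicator_of_mem hω', if_pos]
        · simp
        · rw [snd_coverOrbit, if_neg hne]
          norm_cast
          constructor <;> linarith
      · rw [Set.indicator_of_notMem hω]
        split_ifs <;> simp
    have e2 : ∀ k, (bad k).indicator (1 : Ω → ℝ) ω = ((if ω ∈ bad k then 1 else 0 : ℤ) : ℝ) := by
      intro k
      by_cases hk : ω ∈ bad k <;> simp [hk]
    simp only [e2]
    have key' := (Int.cast_le (R := ℝ)).2 key
    push_cast at key' e1 ⊢
    simp only [N]
    linarith
  have hSi : Integrable (S.indicator (1 : Ω → ℝ)) μ := (integrable_const 1).indicator hS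
  have hBi : ∀ k, Integrable ((bad k).indicator (1 : Ω → ℝ)) μ := fun k =>
    (integrable_const 1).indicator (hbad k)
  have hNτ : Integrable (fun ω => N (τ ω)) μ := hτ.integrable_comp_of_integrable hNi
  have hint := integral_mono (hNτ.add hSi)
    (hNi.add ((integrable_finsetSum (Finset.range (n + 1)) fun k _ => hBi k).const_mul 2)) hpt
  simp only [Pi.add_apply] at hint
  rw [integral_add hNτ hSi, integral_add hNi
    ((integrable_finsetSum (Finset.range (n + 1)) fun k _ => hBi k).const_mul 2),
    integral_const_mul, integral_finsetSum _ fun k _ => hBi k, integral_indicator_one hS] at hint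
  simp only [integral_indicator_one (hbad _)] at hint
  have hinv : ∫ ω, N (τ ω) ∂μ = ∫ ω, N ω ∂μ := by
    conv_rhs => rw [← hτ.map_eq]
    rw [integral_map hτ.measurable.aemeasurable (hNm.aestronglyMeasurable)]
  linarith

end Measure

/-! ### Representatives in the square and exit probabilities -/

instance : IsProbabilityMeasure (volume : Measure UnitAddCircle) :=
  ⟨UnitAddCircle.measure_univ⟩

/-- The representative in `[0, 1)` of a point of the circle. -/
noncomputable def circleRep (x : UnitAddCircle) : ℝ := AddCircle.equivIco 1 0 x

lemma circleRep_mem (x : UnitAddCircle) : circleRep x ∈ Set.Ico (0 : ℝ) 1 := by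
  have h := (AddCircle.equivIco (1 : ℝ) 0 x).2
  exact ⟨h.1, h.2.trans_eq (zero_add 1)⟩

lemma coe_circleRep (x : UnitAddCircle) : (circleRep x : UnitAddCircle) = x :=
  AddCircle.coe_equivIco

lemma circleRep_coe {y : ℝ} (hy : y ∈ Set.Ico (0 : ℝ) 1) : circleRep (y : UnitAddCircle) = y :=
  AddCircle.equivIco_coe_of_mem (by rwa [zero_add])

lemma measurable_circleRep : Measurable circleRep :=
  measurable_subtype_coe.comp (AddCircle.measurableEquivIco (1 : ℝ) 0).measurable

lemma measurableSet_circleRep_add_notMem (s : ℝ) :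
    MeasurableSet {x : UnitAddCircle | circleRep x + s ∉ Set.Ico (0 : ℝ) 1} :=
  ((measurable_circleRep.add_const s) measurableSet_Ico).compl

lemma volume_circleRep_add_notMem_le (s : ℝ) :
    volume {x : UnitAddCircle | circleRep x + s ∉ Set.Ico (0 : ℝ) 1} ≤ ENNReal.ofReal |s| := by
  have hmp := UnitAddCircle.measurePreserving_mk 0
  rw [← hmp.measure_preimage (measurableSet_circleRep_add_notMem s).nullMeasurableSet,
    Measure.restrict_apply (hmp.measurable (measurableSet_circleRep_add_notMem s)), zero_add]
  rcases le_or_gt 0 s with hs | hs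
  · calc _ ≤ volume (Set.Icc (1 - s) 1) := measure_mono ?_
      _ = _ := by rw [Real.volume_Icc, abs_of_nonneg hs]; congr 1; ring
    rintro y ⟨hy, hy0, hy1⟩
    refine ⟨?_, hy1⟩
    rcases hy1.eq_or_lt with rfl | hy1
    · linarith
    · simp only [Set.mem_preimage, Set.mem_ofPred_eq, circleRep_coe ⟨hy0.le, hy1⟩] at hy
      by_contra! h
      exact hy ⟨by linarith, by linarith⟩
  -- The measure is pulled back to `(0, 1]`, whose endpoint 1 has representative 0; it is thrown in
  -- as a null set.
  · calc _ ≤ volume (Set.Icc 0 (-s) ∪ {1}) := measure_mono ?_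
      _ ≤ volume (Set.Icc 0 (-s)) + volume {(1 : ℝ)} := measure_union_le _ _
      _ = _ := by rw [Real.volume_Icc, Real.volume_singleton, add_zero, sub_zero, abs_of_neg hs]
    rintro y ⟨hy, hy0, hy1⟩
    rcases hy1.eq_or_lt with rfl | hy1
    · simp
    · simp only [Set.mem_preimage, Set.mem_ofPred_eq, circleRep_coe ⟨hy0.le, hy1⟩] at hy
      refine Or.inl ⟨hy0.le, ?_⟩
      by_contra! h
      exact hy ⟨by linarith, by linarith⟩

/-- The projection of the plane onto the torus. -/
def torusProj (x : EuclideanSpace ℝ (Fin 2)) : UnitAddTorus (Fin 2) :=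
  fun i => ((x i : ℝ) : UnitAddCircle)

/-- The representative in `[0, 1)²` of a point of the torus. -/
noncomputable def torusRep (ω : UnitAddTorus (Fin 2)) : EuclideanSpace ℝ (Fin 2) :=
  WithLp.toLp 2 fun i => circleRep (ω i)

lemma torusRep_mem (ω : UnitAddTorus (Fin 2)) : torusRep ω ∈ fundamentalSquare :=
  fun i => circleRep_mem (ω i)

lemma torusProj_torusRep (ω : UnitAddTorus (Fin 2)) : torusProj (torusRep ω) = ω :=
  funext fun i => coe_circleRep (ω i)

lemma torusProj_add (x y : EuclideanSpace ℝ (Fin 2)) :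
    torusProj (x + y) = torusProj x + torusProj y := by
  ext i; simp [torusProj]

/-- The points whose representative leaves the square when moved by the vector `x`. -/
def exitSet (x : EuclideanSpace ℝ (Fin 2)) : Set (UnitAddTorus (Fin 2)) :=
  {ω | torusRep ω + x ∉ fundamentalSquare}

lemma exitSet_eq (x : EuclideanSpace ℝ (Fin 2)) :
    exitSet x = ⋃ i, Function.eval i ⁻¹'
      {y : UnitAddCircle | circleRep y + x i ∉ Set.Ico (0 : ℝ) 1} := by
  ext ω
  simp only [exitSet, fundamentalSquare, Set.mem_ofPred_eq, not_forall, Set.mem_iUnion,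
    Set.mem_preimage]
  rfl

lemma measurableSet_exitSet (x : EuclideanSpace ℝ (Fin 2)) : MeasurableSet (exitSet x) := by
  rw [exitSet_eq]
  exact MeasurableSet.iUnion fun i =>
    measurable_pi_apply i (measurableSet_circleRep_add_notMem (x i))

lemma volume_exitSet_le (x : EuclideanSpace ℝ (Fin 2)) :
    volume.real (exitSet x) ≤ 2 * ‖x‖ := by
  have h : volume (exitSet x) ≤ ENNReal.ofReal (2 * ‖x‖) := by
    rw [exitSet_eq]
    refine (measure_iUnion_fintype_le _ _).trans ?_
    have : ∀ i : Fin 2, volume (Function.eval i ⁻¹'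
      {y : UnitAddCircle | circleRep y + x i ∉ Set.Ico (0 : ℝ) 1} : Set (UnitAddTorus (Fin 2))) ≤
        ENNReal.ofReal ‖x‖ := by
      intro i
      rw [volume_pi, (measurePreserving_eval (fun _ : Fin 2 => (volume : Measure UnitAddCircle)) i).measure_preimage
        (measurableSet_circleRep_add_notMem (x i)).nullMeasurableSet]
      exact (volume_circleRep_add_notMem_le _).trans
        (ENNReal.ofReal_le_ofReal (PiLp.norm_apply_le x i))
    refine (Finset.sum_le_sum fun i _ => this i).trans ?_
    simp [ENNReal.ofReal_mul]
  exact ENNReal.toReal_le_of_le_ofReal (by positivity) h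

/-! ### The toral automorphism and its expanding direction -/

lemma toralMap_mul (A B : Matrix.SpecialLinearGroup (Fin 2) ℤ) (ω : UnitAddTorus (Fin 2)) :
    toralMap (A * B) ω = toralMap A (toralMap B ω) := by
  ext i
  simp only [toralMap, Matrix.SpecialLinearGroup.coe_mul, Matrix.mul_apply, Fin.sum_univ_two,
    add_smul, mul_smul, smul_add]
  abel

lemma toralMap_one (ω : UnitAddTorus (Fin 2)) : toralMap 1 ω = ω := by
  ext i
  fin_cases i <;> simp [toralMap]

lemma toralMap_add (A : Matrix.SpecialLinearGroup (Fin 2) ℤ) (ω η : UnitAddTorus (Fin 2)) :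
    toralMap A (ω + η) = toralMap A ω + toralMap A η := by
  ext i
  simp [toralMap, Finset.sum_add_distrib]

lemma continuous_toralMap (A : Matrix.SpecialLinearGroup (Fin 2) ℤ) :
    Continuous (toralMap A) := by
  unfold toralMap
  fun_prop

/-- A continuous surjective endomorphism of a compact group preserves Haar probability. -/
lemma measurePreserving_toralMap (A : Matrix.SpecialLinearGroup (Fin 2) ℤ) :
    MeasurePreserving (toralMap A) := by
  let f : UnitAddTorus (Fin 2) →+ UnitAddTorus (Fin 2) :=
    { toFun := toralMap A
      map_zero' := by ext i; simp [toralMap]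
      map_add' := toralMap_add A }
  refine AddMonoidHom.measurePreserving (f := f) (continuous_toralMap A) (fun ω => ?_) rfl
  exact ⟨toralMap A⁻¹ ω, by
    change toralMap A (toralMap A⁻¹ ω) = ω
    rw [← toralMap_mul, mul_inv_cancel, toralMap_one]⟩

lemma measurePreserving_toralMap_iterate (A : Matrix.SpecialLinearGroup (Fin 2) ℤ) (k : ℕ) :
    MeasurePreserving (toralMap A)^[k] :=
  (measurePreserving_toralMap A).iterate k

lemma toralMap_torusProj (A : Matrix.SpecialLinearGroup (Fin 2) ℤ)
    (x : EuclideanSpace ℝ (Fin 2)) :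
    toralMap A (torusProj x) = torusProj (Matrix.toEuclideanLin (realMatrix A) x) := by
  ext i
  simp only [toralMap, torusProj, ← AddCircle.coe_zsmul, zsmul_eq_mul, Fin.sum_univ_two,
    ← AddCircle.coe_add]
  fin_cases i <;> simp [realMatrix, Matrix.toLpLin_apply]

lemma iterate_toralMap_add_torusProj {A : Matrix.SpecialLinearGroup (Fin 2) ℤ} {β : ℝ}
    {u : EuclideanSpace ℝ (Fin 2)}
    (hu : Module.End.HasEigenvector (Matrix.toEuclideanLin (realMatrix A)) β u)
    (ω : UnitAddTorus (Fin 2)) (s : ℝ) (k : ℕ) :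
    (toralMap A)^[k] (ω + torusProj (s • u)) =
      (toralMap A)^[k] ω + torusProj ((s * β ^ k) • u) := by
  induction k with
  | zero => simp
  | succ k ih =>
    rw [Function.iterate_succ_apply', ih, toralMap_add, toralMap_torusProj, map_smul,
      hu.apply_eq_smul, smul_smul, Function.iterate_succ_apply', pow_succ, mul_assoc]

lemma two_le_of_hasEigenvector {A : Matrix.SpecialLinearGroup (Fin 2) ℤ} {β : ℝ}
    {u : EuclideanSpace ℝ (Fin 2)} (hβ : 1 < β)
    (hu : Module.End.HasEigenvector (Matrix.toEuclideanLin (realMatrix A)) β u) : 2 ≤ β := by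
  have h := hu.apply_eq_smul
  have h0 := congrArg (fun x : EuclideanSpace ℝ (Fin 2) => x 0) h
  have h1 := congrArg (fun x : EuclideanSpace ℝ (Fin 2) => x 1) h
  simp [realMatrix, Matrix.toLpLin_apply] at h0 h1
  have hdet := A.det_coe
  rw [Matrix.det_fin_two] at hdet
  have hdet' : (A 0 0 : ℝ) * A 1 1 - A 0 1 * A 1 0 = 1 := by exact_mod_cast hdet
  have hchar : β * β - (A 0 0 + A 1 1) * β + 1 = 0 := by
    have hne : u 0 ≠ 0 ∨ u 1 ≠ 0 := by
      by_contra! h'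
      apply hu.2
      ext i
      fin_cases i
      · exact h'.1
      · exact h'.2
    rcases hne with hne | hne
    · apply mul_right_cancel₀ hne
      linear_combination (-(β - A 1 1)) * h0 - A 0 1 * h1 - u 0 * hdet'
    · apply mul_right_cancel₀ hne
      linear_combination (-(β - A 0 0)) * h1 - A 1 0 * h0 - u 1 * hdet'
  -- The trace `β + 1 / β` is an integer greater than 2, hence at least 3, which excludes `1 < β <
  -- 2`.
  by_contra! hlt
  have htr : 2 < (A 0 0 + A 1 1 : ℝ) := by nlinarith [sq_nonneg (β - 1)]
  have htr' : 2 < A 0 0 + A 1 1 := by exact_mod_cast htr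
  have h3 : (3 : ℝ) ≤ A 0 0 + A 1 1 := by exact_mod_cast htr'
  nlinarith

/-! ### Growth of the potential along `u` -/

lemma convex_fundamentalSquare : Convex ℝ fundamentalSquare := by
  intro x hx y hy a b ha hb hab i
  exact convex_Ico (0 : ℝ) 1 (hx i) (hy i) ha hb hab

/-- The mean value inequality along a segment of direction `u` in the square. -/
lemma mul_le_periodicLift_sub {v : UnitAddTorus (Fin 2) → ℝ}
    (hv : ContDiffOn ℝ 1 (periodicLift v) fundamentalSquare) {c : ℝ}
    {u : EuclideanSpace ℝ (Fin 2)} (hc : ∀ x ∈ fundamentalSquare, c < squareDirDeriv v u x)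
    {x : EuclideanSpace ℝ (Fin 2)} {s : ℝ} (hs : 0 ≤ s) (hx : x ∈ fundamentalSquare)
    (hxs : x + s • u ∈ fundamentalSquare) :
    c * s ≤ periodicLift v (x + s • u) - periodicLift v x := by
  have hmem : ∀ t ∈ Set.Icc 0 s, x + t • u ∈ fundamentalSquare := by
    intro t ht
    rcases hs.eq_or_lt with rfl | hs
    · have : t = 0 := le_antisymm ht.2 ht.1
      simpa [this] using hx
    · have := convex_fundamentalSquare.add_smul_sub_mem hx hxs
        (t := t / s) ⟨div_nonneg ht.1 hs.le, (div_le_one hs).2 ht.2⟩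
      rwa [add_sub_cancel_left, smul_smul, div_mul_cancel₀ _ hs.ne'] at this
  have hderiv : ∀ t ∈ Set.Icc 0 s, HasDerivWithinAt (fun t => periodicLift v (x + t • u))
      (squareDirDeriv v u (x + t • u)) (Set.Icc 0 s) t := by
    intro t ht
    have h1 := ((hv.differentiableOn one_ne_zero) _ (hmem t ht)).hasFDerivWithinAt
    have h2 : HasDerivWithinAt (fun t : ℝ => x + t • u) u (Set.Icc 0 s) t := by
      simpa using ((hasDerivAt_id t).smul_const u).const_add x |>.hasDerivWithinAt
    exact h1.comp_hasDerivWithinAt t h2 hmem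
  have hd : ∀ t ∈ interior (Set.Icc 0 s), HasDerivAt (fun t => periodicLift v (x + t • u))
      (squareDirDeriv v u (x + t • u)) t := fun t ht =>
    (hderiv t (interior_subset ht)).hasDerivAt (mem_interior_iff_mem_nhds.1 ht)
  have := (convex_Icc 0 s).mul_sub_le_image_sub_of_le_deriv (C := c)
    (fun t ht => (hderiv t ht).continuousWithinAt)
    (fun t ht => (hd t ht).differentiableAt.differentiableWithinAt)
    (fun t ht => by
      rw [(hd t ht).deriv]
      exact (hc _ (hmem t (interior_subset ht))).le)
    0 (Set.left_mem_Icc.2 hs) s (Set.right_mem_Icc.2 hs) hs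
  simpa using this

lemma mul_le_sub_of_notMem_exitSet {v : UnitAddTorus (Fin 2) → ℝ}
    (hv : ContDiffOn ℝ 1 (periodicLift v) fundamentalSquare) {c : ℝ}
    {u : EuclideanSpace ℝ (Fin 2)} (hc : ∀ x ∈ fundamentalSquare, c < squareDirDeriv v u x)
    {s : ℝ} (hs : 0 ≤ s) {ω : UnitAddTorus (Fin 2)} (hω : ω ∉ exitSet (s • u)) :
    c * s ≤ v (ω + torusProj (s • u)) - v ω := by
  have := mul_le_periodicLift_sub hv hc hs (torusRep_mem ω) (not_not.1 hω)
  have h : ∀ x, periodicLift v x = v (torusProj x) := fun _ => rfl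
  rwa [h, h, torusProj_add, torusProj_torusRep] at this

/-! ### Norms of the cocycle and existence of the limit -/

lemma abs_entry_le_l2_opNorm (M : Matrix (Fin 2) (Fin 2) ℝ) (i j : Fin 2) : |M i j| ≤ ‖M‖ := by
  have h := Matrix.l2_opNorm_mulVec M (EuclideanSpace.single j (1 : ℝ))
  have h' := (PiLp.norm_apply_le _ i).trans h
  simpa using h'

lemma one_le_two_mul_sq_l2_opNorm {M : Matrix (Fin 2) (Fin 2) ℝ} (hM : M.det = 1) :
    1 ≤ 2 * ‖M‖ ^ 2 := by
  rw [Matrix.det_fin_two] at hM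
  have h := abs_entry_le_l2_opNorm M
  have h1 : |M 0 0 * M 1 1| ≤ ‖M‖ * ‖M‖ := by
    rw [abs_mul]; exact mul_le_mul (h 0 0) (h 1 1) (abs_nonneg _) (norm_nonneg _)
  have h2 : |M 0 1 * M 1 0| ≤ ‖M‖ * ‖M‖ := by
    rw [abs_mul]; exact mul_le_mul (h 0 1) (h 1 0) (abs_nonneg _) (norm_nonneg _)
  have h3 := (abs_le.1 h1).2
  have h4 := (abs_le.1 h2).1
  nlinarith

lemma neg_log_two_le_log_l2_opNorm {M : Matrix (Fin 2) (Fin 2) ℝ} (hM : M.det = 1) :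
    0 < ‖M‖ ∧ -Real.log 2 ≤ Real.log ‖M‖ := by
  have h := one_le_two_mul_sq_l2_opNorm hM
  have h0 : (1 / 2 : ℝ) ≤ ‖M‖ := by nlinarith [norm_nonneg M]
  refine ⟨by linarith, ?_⟩
  rw [← Real.log_inv]
  exact Real.log_le_log (by norm_num) (by linarith)

section Cocycle

variable (A : Matrix.SpecialLinearGroup (Fin 2) ℤ) (v : UnitAddTorus (Fin 2) → ℝ) (E lam : ℝ)

lemma det_transferMatrix (n : ℕ) (ω : UnitAddTorus (Fin 2)) :
    (transferMatrix A v E lam n ω).det = 1 := by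
  induction n with
  | zero => simp [transferMatrix]
  | succ n ih => rw [transferMatrix, Matrix.det_mul, ih]; simp [schrodingerMatrix]

lemma transferMatrix_add (m n : ℕ) (ω : UnitAddTorus (Fin 2)) :
    transferMatrix A v E lam (m + n) ω =
      transferMatrix A v E lam m ((toralMap A)^[n] ω) * transferMatrix A v E lam n ω := by
  induction m with
  | zero => simp [transferMatrix]
  | succ m ih =>
    rw [Nat.add_right_comm, transferMatrix, ih, transferMatrix, Matrix.mul_assoc,
      Function.iterate_add_apply]

lemma transferMatrix_apply_zero (n : ℕ) (ω : UnitAddTorus (Fin 2)) :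
    transferMatrix A v E lam n ω 0 0 =
        continuant (fun k => E - lam * v ((toralMap A)^[k] ω)) (n + 1) ∧
      transferMatrix A v E lam n ω 1 0 =
        continuant (fun k => E - lam * v ((toralMap A)^[k] ω)) n := by
  induction n with
  | zero => simp [transferMatrix, continuant]
  | succ n ih =>
    simp only [transferMatrix, Matrix.mul_apply, Fin.sum_univ_two, ih.1, ih.2]
    simp [schrodingerMatrix, continuant, sub_eq_add_neg]

variable {v}

lemma measurable_transferMatrix_apply (hv : Measurable v) (n : ℕ) (i j : Fin 2) :
    Measurable fun ω => transferMatrix A v E lam n ω i j := by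
  induction n generalizing i j with
  | zero => simp [transferMatrix]
  | succ n ih =>
    simp only [transferMatrix, Matrix.mul_apply]
    refine Finset.measurable_sum _ fun k _ => Measurable.mul ?_ (ih k j)
    have h := (hv.comp (measurePreserving_toralMap_iterate A n).measurable).const_mul lam
      |>.const_sub E
    fin_cases i <;> fin_cases k <;> simp [schrodingerMatrix]
    exact h

lemma measurable_log_norm_transferMatrix (hv : Measurable v) (n : ℕ) :
    Measurable fun ω => Real.log ‖transferMatrix A v E lam n ω‖ := by
  have hc : Continuous fun x : Fin 2 → Fin 2 → ℝ => ‖Matrix.of x‖ :=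
    (Matrix.ofLinearEquiv ℝ : (Fin 2 → Fin 2 → ℝ) ≃ₗ[ℝ]
      Matrix (Fin 2) (Fin 2) ℝ).toLinearMap.continuous_of_finiteDimensional.norm
  exact Real.measurable_log.comp (hc.measurable.comp (measurable_pi_lambda _ fun i =>
    measurable_pi_lambda _ fun j => measurable_transferMatrix_apply A E lam hv n i j))

lemma exists_norm_schrodingerMatrix_le (hv : ∃ B : ℝ, ∀ ω, |v ω| ≤ B) :
    ∃ M : ℝ, 1 ≤ M ∧ ∀ ω, ‖schrodingerMatrix v E lam ω‖ ≤ M := by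
  obtain ⟨B, hB⟩ := hv
  refine ⟨1 + (‖(!![E, -1; 1, 0] : Matrix (Fin 2) (Fin 2) ℝ)‖ +
    |lam| * B * ‖(!![1, 0; 0, 0] : Matrix (Fin 2) (Fin 2) ℝ)‖), ?_, fun ω => ?_⟩
  · have : 0 ≤ B := (abs_nonneg _).trans (hB 0)
    have : 0 ≤ |lam| * B * ‖(!![1, 0; 0, 0] : Matrix (Fin 2) (Fin 2) ℝ)‖ := by positivity
    linarith [norm_nonneg (!![E, -1; 1, 0] : Matrix (Fin 2) (Fin 2) ℝ)]
  · have h : schrodingerMatrix v E lam ω =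
        !![E, -1; 1, 0] - (lam * v ω) • !![1, 0; 0, 0] := by
      ext i j; fin_cases i <;> fin_cases j <;> simp [schrodingerMatrix]
    rw [h]
    refine (norm_sub_le _ _).trans ?_
    rw [norm_smul, Real.norm_eq_abs, abs_mul]
    have : |lam| * |v ω| * ‖(!![1, 0; 0, 0] : Matrix (Fin 2) (Fin 2) ℝ)‖ ≤
        |lam| * B * ‖(!![1, 0; 0, 0] : Matrix (Fin 2) (Fin 2) ℝ)‖ := by
      gcongr; exact hB ω
    linarith

lemma integrable_log_norm_transferMatrix (hv : Measurable v) (hb : ∃ B : ℝ, ∀ ω, |v ω| ≤ B)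
    (n : ℕ) : Integrable fun ω => Real.log ‖transferMatrix A v E lam n ω‖ := by
  obtain ⟨M, hM1, hM⟩ := exists_norm_schrodingerMatrix_le E lam hb
  have hle : ∀ n ω, ‖transferMatrix A v E lam n ω‖ ≤ M ^ n := by
    intro n ω
    induction n with
    | zero => simp [transferMatrix]
    | succ n ih =>
      rw [transferMatrix, pow_succ']
      exact (norm_mul_le _ _).trans (mul_le_mul (hM _) ih (norm_nonneg _) (by linarith))
  refine Integrable.of_bound
    (measurable_log_norm_transferMatrix A E lam hv n).aestronglyMeasurable
    (Real.log 2 + n * Real.log M) (ae_of_all _ fun ω => ?_)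
  obtain ⟨h0, h1⟩ := neg_log_two_le_log_l2_opNorm (det_transferMatrix A v E lam n ω)
  have h2 := Real.log_le_log h0 (hle n ω)
  rw [Real.log_pow] at h2
  have h3 : 0 ≤ n * Real.log M := mul_nonneg n.cast_nonneg (Real.log_nonneg hM1)
  have h4 : 0 ≤ Real.log 2 := Real.log_nonneg one_le_two
  rw [Real.norm_eq_abs, abs_le]
  constructor <;> linarith

lemma subadditive_integral_log_norm_transferMatrix (hv : Measurable v)
    (hb : ∃ B : ℝ, ∀ ω, |v ω| ≤ B) :
    Subadditive fun n => ∫ ω, Real.log ‖transferMatrix A v E lam n ω‖ := by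
  intro m n
  have hint := integrable_log_norm_transferMatrix A E lam hv hb
  have hT := measurePreserving_toralMap_iterate A n
  have hinv : ∫ ω, Real.log ‖transferMatrix A v E lam m ((toralMap A)^[n] ω)‖ =
      ∫ ω, Real.log ‖transferMatrix A v E lam m ω‖ := by
    conv_rhs => rw [← hT.map_eq]
    rw [integral_map hT.measurable.aemeasurable
      (measurable_log_norm_transferMatrix A E lam hv m).aestronglyMeasurable]
  have hmT := hT.integrable_comp_of_integrable (hint m)
  simp only [Function.comp_def] at hmT
  dsimp only
  rw [← hinv, ← integral_add hmT (hint n)]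
  refine integral_mono (hint _) (hmT.add (hint n)) fun ω => ?_
  have h0 := fun k ω => (neg_log_two_le_log_l2_opNorm (det_transferMatrix A v E lam k ω)).1
  dsimp only [Pi.add_apply]
  rw [← Real.log_mul (h0 _ _).ne' (h0 _ _).ne']
  refine Real.log_le_log (h0 _ _) ?_
  rw [transferMatrix_add]
  exact norm_mul_le _ _

lemma tendsto_averagedLogNorm (hv : Measurable v) (hb : ∃ B : ℝ, ∀ ω, |v ω| ≤ B) :
    Tendsto (averagedLogNorm A v E lam) atTop (𝓝 (lyapunovExponent A v E lam)) := by
  refine tendsto_nhds_limUnder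
    ⟨(subadditive_integral_log_norm_transferMatrix A E lam hv hb).lim, ?_⟩
  have h : averagedLogNorm A v E lam =
      fun n : ℕ => (∫ ω, Real.log ‖transferMatrix A v E lam n ω‖) / n := by
    ext n
    rw [averagedLogNorm, one_div, inv_mul_eq_div]
  rw [h]
  refine (subadditive_integral_log_norm_transferMatrix A E lam hv hb).tendsto_lim
    ⟨-Real.log 2, ?_⟩
  rintro _ ⟨n, rfl⟩
  have h4 : 0 ≤ Real.log 2 := Real.log_nonneg one_le_two
  have h1 := integral_mono (integrable_const (-Real.log 2))
    (integrable_log_norm_transferMatrix A E lam hv hb n) fun ω =>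
      (neg_log_two_le_log_l2_opNorm (det_transferMatrix A v E lam n ω)).2
  rw [integral_const, probReal_univ, one_smul] at h1
  -- At `n = 0` the quotient is `0` by the convention for division by zero.
  rcases n.eq_zero_or_pos with rfl | hn
  · simpa using h4
  · have hn' : (1 : ℝ) ≤ n := by exact_mod_cast hn
    dsimp only
    rw [le_div_iff₀ (by linarith)]
    nlinarith

end Cocycle

/-! ### Small ratios are rare, and the lower bound -/

lemma sum_range_pow_le {β : ℝ} (hβ : 2 ≤ β) (n : ℕ) :
    ∑ k ∈ Finset.range (n + 1), β ^ k ≤ 2 * β ^ n := by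
  induction n with
  | zero => simp
  | succ n ih =>
    rw [Finset.sum_range_succ, pow_succ]
    have : 0 ≤ β ^ n := by positivity
    nlinarith

/-- Values near zero of the quotients of consecutive continuants along the orbit are rare. -/
lemma volume_abs_continuant_div_lt_le {v : UnitAddTorus (Fin 2) → ℝ} (hvm : Measurable v)
    (hv : ContDiffOn ℝ 1 (periodicLift v) fundamentalSquare) {c : ℝ} (hc : 0 < c)
    {A : Matrix.SpecialLinearGroup (Fin 2) ℤ} {β : ℝ} {u : EuclideanSpace ℝ (Fin 2)}
    (hβ : 1 < β) (hu : Module.End.HasEigenvector (Matrix.toEuclideanLin (realMatrix A)) β u)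
    (hu1 : ‖u‖ = 1) (hcv : ∀ x ∈ fundamentalSquare, c < squareDirDeriv v u x)
    {lam : ℝ} (hlam : 0 < lam) (E : ℝ) (n : ℕ) {ε : ℝ} (hε : 0 < ε) :
    volume.real {ω | continuant (fun k => E - lam * v ((toralMap A)^[k] ω)) (n + 1) ≠ 0 ∧
      |continuant (fun k => E - lam * v ((toralMap A)^[k] ω)) (n + 2) /
        continuant (fun k => E - lam * v ((toralMap A)^[k] ω)) (n + 1)| < lam * ε} ≤
      16 / c * ε := by
  have hβ2 := two_le_of_hasEigenvector hβ hu
  have hβ0 : 0 < β := by linarith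
  -- The size of the displacement at time `n`, chosen so that half the resulting drop `lam * c * h`
  -- of the last parameter is `lam * ε`.
  set h := 2 * ε / c
  have hh : 0 ≤ h := by positivity
  have hδ : lam * ε = (lam * (c * h)) / 2 := by simp only [h]; field_simp
  have hiter := measurePreserving_toralMap_iterate A
  have hbadm : ∀ k, MeasurableSet ((toralMap A)^[k] ⁻¹' exitSet ((h / β ^ n * β ^ k) • u)) :=
    fun k => (hiter k).measurable (measurableSet_exitSet _)
  have hs : ∀ k, 0 ≤ h / β ^ n * β ^ k := fun k => by positivity
  have hinc : ∀ k, ∀ ω ∉ (toralMap A)^[k] ⁻¹' exitSet ((h / β ^ n * β ^ k) • u),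
      E - lam * v ((toralMap A)^[k] (ω + torusProj ((h / β ^ n) • u))) ≤
        E - lam * v ((toralMap A)^[k] ω) - lam * (c * (h / β ^ n * β ^ k)) := by
    intro k ω hω
    have := mul_le_sub_of_notMem_exitSet hv hcv (hs k) hω
    rw [iterate_toralMap_add_torusProj hu]
    nlinarith [mul_le_mul_of_nonneg_left this hlam.le]
  rw [hδ]
  refine (measureReal_abs_continuant_div_lt_le (μ := volume)
    (τ := fun ω => ω + torusProj ((h / β ^ n) • u))
    (a := fun k ω => E - lam * v ((toralMap A)^[k] ω))
    (measurePreserving_add_right volume _)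
    (fun k => ((hvm.comp (hiter k).measurable).const_mul lam).const_sub E)
    hbadm (by positivity) (fun k _ ω hω => (hinc k ω hω).trans ?_)
    (fun ω hω => (hinc n ω hω).trans_eq ?_)).trans ?_
  · have : 0 ≤ lam * (c * (h / β ^ n * β ^ k)) :=
      mul_nonneg hlam.le (mul_nonneg hc.le (hs k))
    linarith
  · rw [div_mul_cancel₀ _ (by positivity)]
  · have hb : ∀ k, volume.real ((toralMap A)^[k] ⁻¹' exitSet ((h / β ^ n * β ^ k) • u)) ≤
        2 * (h / β ^ n) * β ^ k := by
      intro k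
      rw [(hiter k).measureReal_preimage (measurableSet_exitSet _).nullMeasurableSet]
      refine (volume_exitSet_le _).trans_eq ?_
      rw [norm_smul, hu1, Real.norm_of_nonneg (hs k)]
      ring
    calc _ ≤ 2 * ∑ k ∈ Finset.range (n + 1), 2 * (h / β ^ n) * β ^ k := by
          gcongr with k; exact hb k
      _ = 4 * (h / β ^ n) * ∑ k ∈ Finset.range (n + 1), β ^ k := by
          rw [← Finset.mul_sum]; ring
      _ ≤ 4 * (h / β ^ n) * (2 * β ^ n) := by
          gcongr; exact sum_range_pow_le hβ2 n
      _ = 16 / c * ε := by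
          have := (pow_pos hβ0 n).ne'
          simp only [h]; field_simp; ring

/-- A nonzero random variable which is within `r * ε` of zero with probability at most `K * ε`
has a logarithm whose part below `log r` has mean at most `K`. -/
lemma integrable_posPart_log_sub {Ω : Type*} [MeasurableSpace Ω] {μ : Measure Ω}
    [IsFiniteMeasure μ] {X : Ω → ℝ} (hX : Measurable X) (h0 : ∀ᵐ ω ∂μ, X ω ≠ 0) {r K : ℝ}
    (hr : 0 < r) (hK : 0 ≤ K)
    (h : ∀ ε : ℝ, 0 < ε → μ.real {ω | X ω ≠ 0 ∧ |X ω| < r * ε} ≤ K * ε) :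
    Integrable (fun ω => max 0 (Real.log r - Real.log |X ω|)) μ ∧
      ∫ ω, max 0 (Real.log r - Real.log |X ω|) ∂μ ≤ K := by
  set g := fun ω => max 0 (Real.log r - Real.log |X ω|)
  have hg0 : ∀ ω, 0 ≤ g ω := fun ω => le_max_left _ _
  have hgm : Measurable g :=
    measurable_const.max ((Real.measurable_log.comp hX.norm).const_sub _)
  have hlint : ∫⁻ ω, ENNReal.ofReal (g ω) ∂μ ≤ ENNReal.ofReal K := by
    -- Layer cake: the event `t < g` forces `|X| < r * exp (-t)`, and `K * exp (-t)` integrates to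
    -- `K`.
    rw [lintegral_eq_lintegral_meas_lt μ (ae_of_all _ hg0) hgm.aemeasurable]
    have hint : IntegrableOn (fun t => K * Real.exp (-t)) (Set.Ioi 0) :=
      (integrableOn_exp_neg_Ioi 0).const_mul K
    calc _ ≤ ∫⁻ t in Set.Ioi 0, ENNReal.ofReal (K * Real.exp (-t)) := by
          refine setLIntegral_mono' measurableSet_Ioi fun t ht => ?_
          have hle : μ {ω | t < g ω} ≤ μ {ω | X ω ≠ 0 ∧ |X ω| < r * Real.exp (-t)} := by
            refine measure_mono_ae ?_
            filter_upwards [h0] with ω hω htg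
            refine ⟨hω, ?_⟩
            have htg' : t < Real.log r - Real.log |X ω| := by
              rcases lt_max_iff.1 htg with h | h
              · exact absurd h (not_lt.2 (le_of_lt ht))
              · exact h
            rw [← Real.log_lt_log_iff (abs_pos.2 hω) (by positivity),
              Real.log_mul hr.ne' (Real.exp_pos _).ne', Real.log_exp]
            linarith
          refine hle.trans ?_
          rw [← ENNReal.ofReal_toReal (measure_ne_top μ _)]
          exact ENNReal.ofReal_le_ofReal (h _ (Real.exp_pos _))
      _ = ENNReal.ofReal (∫ t in Set.Ioi 0, K * Real.exp (-t)) :=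
          (ofReal_integral_eq_lintegral_ofReal hint
            (ae_of_all _ fun t => by positivity)).symm
      _ = ENNReal.ofReal K := by
          rw [integral_const_mul, integral_exp_neg_Ioi_zero, mul_one]
  refine ⟨⟨hgm.aestronglyMeasurable, ?_⟩, ?_⟩
  · rw [hasFiniteIntegral_iff_ofReal (ae_of_all _ hg0)]
    exact hlint.trans_lt ENNReal.ofReal_lt_top
  · rw [integral_eq_lintegral_of_nonneg_ae (ae_of_all _ hg0) hgm.aestronglyMeasurable]
    exact ENNReal.toReal_le_of_le_ofReal hK hlint

/-- The zero set of `X` lies in the small-ratio event for every `ε`. It is applied to consecutive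
continuants, which never vanish together. -/
lemma ae_ne_zero_of_forall_measureReal_le {Ω : Type*} [MeasurableSpace Ω] {μ : Measure Ω}
    [IsFiniteMeasure μ] {X Y : Ω → ℝ} {r K : ℝ} (hr : 0 < r)
    (hXY : ∀ ω, X ω = 0 → Y ω ≠ 0)
    (h : ∀ ε : ℝ, 0 < ε → μ.real {ω | Y ω ≠ 0 ∧ |X ω / Y ω| < r * ε} ≤ K * ε) :
    ∀ᵐ ω ∂μ, X ω ≠ 0 := by
  have hle : ∀ ε : ℝ, 0 < ε → μ.real {ω | X ω = 0} ≤ K * ε := by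
    refine fun ε hε => (measureReal_mono ?_).trans (h ε hε)
    intro ω hω
    refine ⟨hXY ω hω, ?_⟩
    have hω' : X ω = 0 := hω
    rw [hω', zero_div, abs_zero]
    positivity
  have hlim : Tendsto (fun ε => K * ε) (𝓝[>] 0) (𝓝 0) := by
    have : Tendsto (fun ε : ℝ => K * ε) (𝓝 0) (𝓝 (K * 0)) := tendsto_id.const_mul K
    rw [mul_zero] at this
    exact this.mono_left nhdsWithin_le_nhds
  have h0 : μ.real {ω | X ω = 0} ≤ 0 :=
    ge_of_tendsto hlim (eventually_nhdsWithin_of_forall hle)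
  rw [ae_iff]
  simp only [ne_eq, not_not]
  exact (measureReal_eq_zero_iff).1 (le_antisymm h0 measureReal_nonneg)

lemma mul_log_sub_le_integral_log_norm_transferMatrix {v : UnitAddTorus (Fin 2) → ℝ}
    (hvm : Measurable v) (hb : ∃ B : ℝ, ∀ ω, |v ω| ≤ B)
    (hv : ContDiffOn ℝ 1 (periodicLift v) fundamentalSquare) {c : ℝ} (hc : 0 < c)
    {A : Matrix.SpecialLinearGroup (Fin 2) ℤ} {β : ℝ} {u : EuclideanSpace ℝ (Fin 2)}
    (hβ : 1 < β) (hu : Module.End.HasEigenvector (Matrix.toEuclideanLin (realMatrix A)) β u)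
    (hu1 : ‖u‖ = 1) (hcv : ∀ x ∈ fundamentalSquare, c < squareDirDeriv v u x)
    {lam : ℝ} (hlam : 0 < lam) (E : ℝ) (n : ℕ) :
    n * (Real.log lam - 16 / c) ≤ ∫ ω, Real.log ‖transferMatrix A v E lam n ω‖ := by
  set D : ℕ → UnitAddTorus (Fin 2) → ℝ := fun n ω =>
    continuant (fun k => E - lam * v ((toralMap A)^[k] ω)) n
  have hDm : ∀ n, Measurable (D n) := measurable_continuant fun k =>
    ((hvm.comp (measurePreserving_toralMap_iterate A k).measurable).const_mul lam).const_sub E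
  have hsmall : ∀ n (ε : ℝ), 0 < ε →
      volume.real {ω | D (n + 1) ω ≠ 0 ∧ |D (n + 2) ω / D (n + 1) ω| < lam * ε} ≤
        16 / c * ε := fun n ε hε =>
    volume_abs_continuant_div_lt_le hvm hv hc hβ hu hu1 hcv hlam E n hε
  have hne : ∀ n, ∀ᵐ ω, D (n + 1) ω ≠ 0 := by
    intro n
    cases n with
    | zero => exact ae_of_all _ fun ω => one_ne_zero
    | succ n =>
      exact ae_ne_zero_of_forall_measureReal_le hlam
        (fun ω h => (continuant_ne_zero_or _ (n + 1)).resolve_right (not_not.2 h)) (hsmall n)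
  have hsmall_ratio : ∀ n (ε : ℝ), 0 < ε → volume.real {ω | D (n + 2) ω / D (n + 1) ω ≠ 0 ∧
      |D (n + 2) ω / D (n + 1) ω| < lam * ε} ≤ 16 / c * ε := by
    refine fun n ε hε => (measureReal_mono ?_).trans (hsmall n ε hε)
    exact fun ω hω => ⟨fun h => hω.1 (by rw [h, div_zero]), hω.2⟩
  have hg : ∀ n, _ := fun n => integrable_posPart_log_sub (μ := volume)
    (X := fun ω => D (n + 2) ω / D (n + 1) ω) (K := 16 / c) ((hDm (n + 2)).div (hDm (n + 1)))
    (by filter_upwards [hne n, hne (n + 1)] with ω h1 h2 using div_ne_zero h2 h1) hlam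
    (by positivity) (hsmall_ratio n)
  set g : ℕ → UnitAddTorus (Fin 2) → ℝ := fun n ω =>
    max 0 (Real.log lam - Real.log |D (n + 2) ω / D (n + 1) ω|)
  have hsum : Integrable fun ω => ∑ k ∈ Finset.range n, g k ω :=
    integrable_finsetSum _ fun k _ => (hg k).1
  have hpt : ∀ᵐ ω, n * Real.log lam - ∑ k ∈ Finset.range n, g k ω ≤
      Real.log ‖transferMatrix A v E lam n ω‖ := by
    filter_upwards [ae_all_iff.2 hne] with ω hω
    -- Telescoping of `log |D (k + 2)| - log |D (k + 1)|`, starting from `D 1 = 1`.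
    have htel : ∀ m : ℕ, m * Real.log lam - ∑ k ∈ Finset.range m, g k ω ≤
        Real.log |D (m + 1) ω| := by
      intro m
      induction m with
      | zero => simp [D, continuant]
      | succ m ih =>
        have h1 : Real.log lam - Real.log |D (m + 2) ω / D (m + 1) ω| ≤ g m ω :=
          le_max_right _ _
        rw [abs_div, Real.log_div (abs_ne_zero.2 (hω (m + 1))) (abs_ne_zero.2 (hω m))] at h1
        rw [Finset.sum_range_succ]
        push_cast
        linarith
    refine (htel n).trans (Real.log_le_log (abs_pos.2 (hω n)) ?_)
    have := abs_entry_le_l2_opNorm (transferMatrix A v E lam n ω) 0 0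
    rwa [(transferMatrix_apply_zero A v E lam n ω).1] at this
  have hint := integral_mono_ae ((integrable_const _).sub hsum)
    (integrable_log_norm_transferMatrix A E lam hvm hb n) hpt
  simp only [Pi.sub_apply] at hint
  rw [integral_sub (integrable_const _) hsum, integral_const, probReal_univ, one_smul,
    integral_finsetSum _ fun k _ => (hg k).1] at hint
  have hle : ∑ k ∈ Finset.range n, ∫ ω, g k ω ≤ n * (16 / c) :=
    (Finset.sum_le_sum fun k _ => (hg k).2).trans_eq (by simp)
  linarith

theorem theorem2p5
    (v : UnitAddTorus (Fin 2) → ℝ)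
    (hv_meas : Measurable v)
    (hv_bdd : ∃ B : ℝ, ∀ ω, |v ω| ≤ B)
    (hv_C1 : ContDiffOn ℝ 1 (periodicLift v) fundamentalSquare)
    (c : ℝ) (hc : 0 < c) :
    ∃ C₀ : ℝ, 0 < C₀ ∧
      ∀ (A : Matrix.SpecialLinearGroup (Fin 2) ℤ) (β : ℝ) (u : EuclideanSpace ℝ (Fin 2)),
        1 < β →
        Module.End.HasEigenvector (Matrix.toEuclideanLin (realMatrix A)) β u →
        ‖u‖ = 1 →
        (∀ x ∈ fundamentalSquare, c < squareDirDeriv v u x) →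
        ∀ lam : ℝ, 0 < lam → ∀ E : ℝ,
          (∀ n : ℕ, Integrable (fun ω => Real.log ‖transferMatrix A v E lam n ω‖)) ∧
          Tendsto (averagedLogNorm A v E lam) atTop (𝓝 (lyapunovExponent A v E lam)) ∧
          Real.log lam - C₀ < lyapunovExponent A v E lam := by
  -- The limit only inherits a non-strict bound with `16 / c`; the extra 1 makes it strict.
  refine ⟨16 / c + 1, by positivity, fun A β u hβ hu hu1 hcv lam hlam E => ?_⟩
  have hlim := tendsto_averagedLogNorm A E lam hv_meas hv_bdd
  refine ⟨integrable_log_norm_transferMatrix A E lam hv_meas hv_bdd, hlim, ?_⟩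
  have hge : Real.log lam - 16 / c ≤ lyapunovExponent A v E lam := by
    refine ge_of_tendsto hlim ?_
    filter_upwards [eventually_gt_atTop 0] with n hn
    have hn' : (0 : ℝ) < n := by exact_mod_cast hn
    rw [averagedLogNorm, one_div, inv_mul_eq_div, le_div_iff₀ hn', mul_comm]
    exact mul_log_sub_le_integral_log_norm_transferMatrix hv_meas hv_bdd hv_C1 hc hβ hu hu1 hcv
      hlam E n
  linarith
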